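/- Let $d=2$. Consider $n$ agents and a location-scale distribution map: a feature $x\in\mathbb{R}^2$ and a noise $x_0\in\mathbb{R}$ are drawn jointly from a fixed law with finite second moments, and if the deployed model profile is $\vec\theta=(\theta^1,\dots,\theta^n)\in\Theta^n$, where $\Theta=\{\theta\in\mathbb{R}^2:\theta_1,\theta_2\ge 0,\ \theta_1+\theta_2=1\}$, the outcome is $y=\langle\theta^0-\sum_{i=1}^n\lambda_i\theta^i,\,x\rangle+x_0$, with $\theta^0\in\mathbb{R}^2$ and influence parameters $\lambda_i>0$. Put $A=\mathbb{E}[xx^\top]$ and $b=A\theta^0+\mathbb{E}[x_0x]$. Let $\ell(\vec\theta,\theta')=\mathbb{E}[(y-\langle\theta',x\rangle)^2]$, where $(x,y)$ follows the law induced by $\vec\theta$, and let $g^i(\vec\theta)=\nabla_{\theta'}\ell(\vec\theta,\theta')|_{\theta'=\theta^i}$. With a common learning rate $\eta>0$, the exponentiated-gradient dynamics on $\Theta^n$ are $$\theta^i_{t+1,k}=\frac{\theta^i_{t,k}\exp(-\eta\, g^i_k(\vec\theta_t))}{\sum_{l=1}^2\theta^i_{t,l}\exp(-\eta\, g^i_l(\vec\theta_t))},\qquad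 i=1,\dots,n,\ k=1,2 .$$ **Theorem (Chaos).** Fix $A$, $b$ and $\eta>0$, and suppose that $A$ is strictly diagonally dominant, i.e. $|A_{11}|>|A_{12}|$ and $|A_{22}|>|A_{21}|$, and that $A_{11}\ne A_{22}$. Then there is a constant $L^*>0$, depending only on $A$, $b$ and $\eta$, such that for every number $n$ of agents and every location-scale distribution map as above with these $A$ and $b$ and with $\sum_{i=1}^n\lambda_i\ge L^*$, the dynamics on $\Theta^n$ are Li–Yorke chaotic: there is an uncountable set $S\subset\Theta^n$ such that for any two distinct points of $S$ the distance between their orbits at time $t$ has $\liminf_{t\to\infty}$ equal to $0$ and $\limsup_{t\to\infty}$ positive. Moreover, for every integer $m\ge 1$ the dynamics have a periodic orbit of least period $m$. -/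

import Mathlib

open MeasureTheory Filter

noncomputable section

/-! ### Li–Yorke chaos -/

/-- `(x, x')` is a Li–Yorke pair for `f` : the liminf of the distances between the two orbits is `0`
and the limsup is positive.  (Distances are taken in `[0, ∞]`, so that the limsup is always
meaningful.) -/
def IsLiYorkePair {X : Type*} [MetricSpace X] (f : X → X) (x x' : X) : Prop :=
  liminf (fun t : ℕ => edist (f^[t] x) (f^[t] x')) atTop = 0 ∧
    0 < limsup (fun t : ℕ => edist (f^[t] x) (f^[t] x')) atTop

/-- A map is Li–Yorke chaotic if it has an uncountable scrambled set. -/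
def IsLiYorkeChaotic {X : Type*} [MetricSpace X] (f : X → X) : Prop :=
  ∃ S : Set X, ¬ S.Countable ∧ S.Pairwise (IsLiYorkePair f)

/-- (Strict, row) diagonal dominance of a real matrix. -/
def IsDiagonallyDominant {d : ℕ} (A : Matrix (Fin d) (Fin d) ℝ) : Prop :=
  ∀ k, ∑ l ∈ Finset.univ.erase k, |A k l| < |A k k|

/-! ### Multi-agent performative prediction with a location-scale distribution map -/

/-- The data of a multi-agent location-scale distribution map with `d` features and `n` agents:
the static law `law` of (feature, noise), with finite second moments, the vector `θ₀`, and the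
positive influence parameters. -/
structure LocationScaleMap (d n : ℕ) where
  law : Measure ((Fin d → ℝ) × ℝ)
  isProbabilityMeasure : IsProbabilityMeasure law
  memLp_feature : ∀ k, MemLp (fun z : (Fin d → ℝ) × ℝ => z.1 k) 2 law
  memLp_noise : MemLp (fun z : (Fin d → ℝ) × ℝ => z.2) 2 law
  θ₀ : Fin d → ℝ
  influence : Fin n → ℝ
  influence_pos : ∀ i, 0 < influence i

namespace LocationScaleMap

variable {d n : ℕ} (M : LocationScaleMap d n)

/-- The matrix `A = 𝔼[x xᵀ]`. -/
def A : Matrix (Fin d) (Fin d) ℝ :=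
  Matrix.of fun k l => ∫ z, z.1 k * z.1 l ∂M.law

/-- The vector `b = A θ₀ + 𝔼[x₀ x]`. -/
def b : Fin d → ℝ :=
  M.A.mulVec M.θ₀ + fun k => ∫ z, z.2 * z.1 k ∂M.law

/-- The collective influence `∑ i, λ_i`. -/
def collectiveInfluence : ℝ := ∑ i, M.influence i

/-- The law of the data point `(x, y)` after the profile `θ` is deployed, where
`y = ⟨θ₀ - ∑ i, λ_i θ^i, x⟩ + x₀`. -/
def distribution (θ : Fin n → Fin d → ℝ) : Measure ((Fin d → ℝ) × ℝ) :=
  M.law.map fun z => (z.1, (M.θ₀ - ∑ i, M.influence i • θ i) ⬝ᵥ z.1 + z.2)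

/-- The decoupled performative loss: the mean squared error of the linear model `θ'` on the data
distribution induced by the deployed profile `θ`. -/
def loss (θ : Fin n → Fin d → ℝ) (θ' : Fin d → ℝ) : ℝ :=
  ∫ z, (z.2 - θ' ⬝ᵥ z.1) ^ 2 ∂M.distribution θ

/-- The gradient of the decoupled loss with respect to the predictive model; its `k`-th
coordinate is the derivative in the direction of the `k`-th unit vector. -/
def grad (θ : Fin n → Fin d → ℝ) (θ' : Fin d → ℝ) : Fin d → ℝ :=
  fun k => fderiv ℝ (M.loss θ) θ' (Pi.single k 1)

end LocationScaleMap

/-- One step of exponentiated gradient on the simplex, with gradient `g` and learning rate `η`. -/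
def expGradStep {d : ℕ} (η : ℝ) (g : Fin d → ℝ) (θ : stdSimplex ℝ (Fin d)) :
    stdSimplex ℝ (Fin d) :=
  ⟨fun k => θ.1 k * Real.exp (-η * g k) / ∑ l, θ.1 l * Real.exp (-η * g l), by
    have hnn : ∀ l, 0 ≤ θ.1 l * Real.exp (-η * g l) := fun l =>
      mul_nonneg (θ.2.1 l) (Real.exp_pos _).le
    have hpos : 0 < ∑ l, θ.1 l * Real.exp (-η * g l) := by
      have hex : ∃ l, 0 < θ.1 l := by
        by_contra! h
        have h1 := θ.2.2
        have h2 : ∑ l, θ.1 l ≤ 0 := Finset.sum_nonpos fun l _ => h l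
        linarith
      obtain ⟨l, hl⟩ := hex
      exact Finset.sum_pos' (fun l _ => hnn l)
        ⟨l, Finset.mem_univ l, mul_pos hl (Real.exp_pos _)⟩
    refine ⟨fun k => div_nonneg (hnn k) hpos.le, ?_⟩
    rw [← Finset.sum_div]
    exact div_self hpos.ne'⟩

/-- One round of the learning dynamics on model profiles `Θ^n` (`Θ` the simplex): each agent `i`
applies exponentiated gradient with learning rate `η i` and the gradient of its own loss on the
distribution induced by the current profile. -/
def LocationScaleMap.dynamics {d n : ℕ} (M : LocationScaleMap d n) (η : Fin n → ℝ)
    (θ : Fin n → stdSimplex ℝ (Fin d)) : Fin n → stdSimplex ℝ (Fin d) :=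
  fun i => expGradStep (η i) (M.grad (fun j => (θ j).1) (θ i).1) (θ i)

end

/-! If all agents share one model, they keep sharing it, and the common weight `p` on coordinate
`k₀` evolves by the interval map F(p) = p / (p + (1 - p) exp(c (p - q))). Here c grows linearly in
the collective influence, and q tends to ρ = a₁ / (a₀ + a₁), where aᵢ is the diagonal entry minus
the off-diagonal one. Dominance gives ρ > 0; unequal diagonal entries give ρ < 1/2 once `k₀` carries
the larger one. The symmetric profiles form an isometric copy of [0, 1] (`semiconj_dynamics`,
`edist_weightPoint`), so chaos of F suffices.

For large c the fixed point q is strongly repelling, and it is reached again from points near 2q in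
two steps. One step divides the odds p / (1 - p) by exp(c (p - q)), so two steps divide them by
exp(c (p + F p - 2q)). Near 2q the first image is almost 0, hence F ∘ F drops from almost 1 to
almost 0 across 2q; since 2q < 1 this happens inside the interval. Small intervals I₁ around q, I₂
around 2q and I₀ near 0 then satisfy: I₂ covers I₀, while I₀ and I₁ each cover I₁ and I₂
(`exists_isSnapBackTriple`).

Every symbol sequence in which 2 and only 2 is followed by 0 is therefore realised by an orbit. The
cycle 2, 0, 1, …, 1 yields each period, and sequences with sparse excursions coded by bits yield an
uncountable scrambled set (`exists_scrambled`). -/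

/-! ### Interval maps with a Markov-type covering pattern -/

/-- If `f` takes the values `c ≤ d` at the ends of an interval, some subinterval is mapped exactly
onto `[c, d]`. -/
theorem exists_Icc_image_eq_of_endpoints {f : ℝ → ℝ} (hf : Continuous f) {u v c d : ℝ}
    (huv : u ≤ v) (hcd : c ≤ d) (hu : f u = c) (hv : f v = d) :
    ∃ a b, a ≤ b ∧ Set.Icc a b ⊆ Set.Icc u v ∧ f '' Set.Icc a b = Set.Icc c d := by
  -- Take the last point with value `c`, then the first later point with value `d`: leaving `[c, d]`
  -- in between would force another crossing.
  obtain ⟨a, ⟨⟨hua, hav⟩, hfa⟩, ha⟩ :=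
    (isCompact_Icc.inter_right (isClosed_singleton.preimage hf) :
      IsCompact (Set.Icc u v ∩ f ⁻¹' {c})).exists_isGreatest ⟨u, ⟨le_rfl, huv⟩, hu⟩
  obtain ⟨b, ⟨⟨hab, hbv⟩, hfb⟩, hb⟩ :=
    (isCompact_Icc.inter_right (isClosed_singleton.preimage hf) :
      IsCompact (Set.Icc a v ∩ f ⁻¹' {d})).exists_isLeast ⟨v, ⟨hav, le_rfl⟩, hv⟩
  simp only [Set.mem_preimage, Set.mem_singleton_iff] at hfa hfb
  refine ⟨a, b, hab, Set.Icc_subset_Icc hua hbv, Set.Subset.antisymm ?_ ?_⟩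
  · rintro _ ⟨x, ⟨hax, hxb⟩, rfl⟩
    constructor
    · by_contra! h
      obtain ⟨y, ⟨hxy, hyb⟩, hy⟩ := intermediate_value_Icc hxb hf.continuousOn
        (show c ∈ Set.Icc (f x) (f b) from ⟨h.le, by rw [hfb]; exact hcd⟩)
      have hya : y ≤ a := ha ⟨⟨hua.trans (hax.trans hxy), hyb.trans hbv⟩, hy⟩
      have : x = y := le_antisymm hxy (hya.trans hax)
      rw [this] at h
      exact absurd hy h.ne
    · by_contra! h
      obtain ⟨y, ⟨hay, hyx⟩, hy⟩ := intermediate_value_Icc hax hf.continuousOn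
        (show d ∈ Set.Icc (f a) (f x) from ⟨by rw [hfa]; exact hcd, h.le⟩)
      have hby : b ≤ y := hb ⟨⟨hay, hyx.trans (hxb.trans hbv)⟩, hy⟩
      have : x = y := le_antisymm (hxb.trans hby) hyx
      rw [this] at h
      exact absurd hy h.ne'
  · have := intermediate_value_Icc hab hf.continuousOn
    rwa [hfa, hfb] at this

theorem exists_Icc_image_eq {f : ℝ → ℝ} (hf : Continuous f) {a b c d : ℝ}
    (hcd : c ≤ d) (h : Set.Icc c d ⊆ f '' Set.Icc a b) :
    ∃ a' b', a' ≤ b' ∧ Set.Icc a' b' ⊆ Set.Icc a b ∧ f '' Set.Icc a' b' = Set.Icc c d := by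
  obtain ⟨u, hu, hfu⟩ := h (Set.left_mem_Icc.2 hcd)
  obtain ⟨v, hv, hfv⟩ := h (Set.right_mem_Icc.2 hcd)
  rcases le_total u v with huv | hvu
  · obtain ⟨a', b', h1, h2, h3⟩ := exists_Icc_image_eq_of_endpoints hf huv hcd hfu hfv
    exact ⟨a', b', h1, h2.trans (Set.Icc_subset_Icc hu.1 hv.2), h3⟩
  · obtain ⟨a', b', h1, h2, h3⟩ := exists_Icc_image_eq_of_endpoints (f := fun x => -f x) hf.neg hvu
      (neg_le_neg hcd) (by rw [hfv]) (by rw [hfu])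
    refine ⟨a', b', h1, h2.trans (Set.Icc_subset_Icc hv.1 hu.2), ?_⟩
    have h4 : (fun x => -x) '' ((fun x => -f x) '' Set.Icc a' b') = f '' Set.Icc a' b' := by
      rw [Set.image_image]; simp
    rw [← h4, h3]
    simp

/-- A finite chain of intervals, each covered by the image of its predecessor, is followed by a
subinterval of the first one. -/
theorem exists_Icc_iterate_image_eq {f : ℝ → ℝ} (hf : Continuous f) {lo hi : ℕ → ℝ}
    (hle : ∀ k, lo k ≤ hi k) (n : ℕ)
    (hcov : ∀ k < n, Set.Icc (lo (k + 1)) (hi (k + 1)) ⊆ f '' Set.Icc (lo k) (hi k)) :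
    ∃ a b, a ≤ b ∧ (∀ k ≤ n, ∀ x ∈ Set.Icc a b, f^[k] x ∈ Set.Icc (lo k) (hi k)) ∧
      f^[n] '' Set.Icc a b = Set.Icc (lo n) (hi n) := by
  induction n with
  | zero =>
    refine ⟨lo 0, hi 0, hle 0, fun k hk x hx => ?_, by simp⟩
    obtain rfl : k = 0 := by omega
    simpa using hx
  | succ n ih =>
    obtain ⟨a, b, hab, h1, h2⟩ := ih fun k hk => hcov k (by omega)
    have h3 : Set.Icc (lo (n + 1)) (hi (n + 1)) ⊆ f^[n + 1] '' Set.Icc a b := by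
      rw [Function.iterate_succ', Set.image_comp, h2]
      exact hcov n (by omega)
    obtain ⟨a', b', h4, h5, h6⟩ := exists_Icc_image_eq (hf.iterate _) (hle _) h3
    refine ⟨a', b', h4, fun k hk x hx => ?_, h6⟩
    rcases Nat.lt_or_ge n k with h | h
    · obtain rfl : k = n + 1 := by omega
      exact h6 ▸ Set.mem_image_of_mem _ hx
    · exact h1 k h x (h5 hx)

/-- Preimages of the two endpoints in the interval give `f - id` opposite signs. -/
theorem exists_isFixedPt_of_subset_image {f : ℝ → ℝ} (hf : Continuous f) {a b : ℝ} (hab : a ≤ b)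
    (h : Set.Icc a b ⊆ f '' Set.Icc a b) : ∃ x ∈ Set.Icc a b, Function.IsFixedPt f x := by
  obtain ⟨u, hu, hfu⟩ := h (Set.left_mem_Icc.2 hab)
  obtain ⟨v, hv, hfv⟩ := h (Set.right_mem_Icc.2 hab)
  obtain ⟨x, hx, hfx⟩ := intermediate_value_uIcc (a := u) (b := v) (f := fun x => f x - x)
    (by fun_prop)
    (show (0 : ℝ) ∈ Set.uIcc (f u - u) (f v - v) from
      Set.mem_uIcc.2 (Or.inl ⟨by linarith [hu.1], by linarith [hv.2]⟩))
  exact ⟨x, Set.uIcc_subset_Icc hu hv hx, sub_eq_zero.1 hfx⟩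

/-- A closed chain of intervals carries a periodic point. -/
theorem exists_isPeriodicPt_of_chain {f : ℝ → ℝ} (hf : Continuous f) {lo hi : ℕ → ℝ}
    (hle : ∀ k, lo k ≤ hi k) (n : ℕ)
    (hcov : ∀ k < n, Set.Icc (lo (k + 1)) (hi (k + 1)) ⊆ f '' Set.Icc (lo k) (hi k))
    (hlo : lo n = lo 0) (hhi : hi n = hi 0) :
    ∃ x, Function.IsPeriodicPt f n x ∧ ∀ k ≤ n, f^[k] x ∈ Set.Icc (lo k) (hi k) := by
  obtain ⟨a, b, hab, h1, h2⟩ := exists_Icc_iterate_image_eq hf hle n hcov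
  obtain ⟨x, hx, hfx⟩ := exists_isFixedPt_of_subset_image (hf.iterate n) hab (by
    rw [h2, hlo, hhi]
    exact fun x hx => by simpa using h1 0 (Nat.zero_le n) x hx)
  exact ⟨x, hfx, fun k hk => h1 k hk x hx⟩

/-- An infinite chain of intervals is followed by some orbit. -/
theorem exists_forall_iterate_mem_of_chain {f : ℝ → ℝ} (hf : Continuous f) {lo hi : ℕ → ℝ}
    (hle : ∀ k, lo k ≤ hi k)
    (hcov : ∀ k, Set.Icc (lo (k + 1)) (hi (k + 1)) ⊆ f '' Set.Icc (lo k) (hi k)) :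
    ∃ x, ∀ k, f^[k] x ∈ Set.Icc (lo k) (hi k) := by
  -- Cantor intersection: finite chains make each `C n` nonempty, and `C 0` lies in a compact
  -- interval.
  let C : ℕ → Set ℝ := fun n => ⋂ k ≤ n, f^[k] ⁻¹' Set.Icc (lo k) (hi k)
  have hC : ∀ n, IsClosed (C n) := fun n =>
    isClosed_biInter fun k _ => isClosed_Icc.preimage (hf.iterate k)
  have hne : (⋂ n, C n).Nonempty := by
    refine IsCompact.nonempty_iInter_of_sequence_nonempty_isCompact_isClosed C
      (fun n => Set.biInter_subset_biInter_left fun k hk => Nat.le_succ_of_le hk) (fun n => ?_)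
      ?_ hC
    · obtain ⟨a, b, hab, h1, -⟩ := exists_Icc_iterate_image_eq hf hle n fun k _ => hcov k
      exact ⟨a, Set.mem_iInter₂.2 fun k hk => h1 k hk a (Set.left_mem_Icc.2 hab)⟩
    · refine isCompact_Icc.of_isClosed_subset (hC 0) (s := Set.Icc (lo 0) (hi 0)) fun x hx => ?_
      simpa using Set.mem_iInter₂.1 hx 0 le_rfl
  obtain ⟨x, hx⟩ := hne
  exact ⟨x, fun k => Set.mem_iInter₂.1 (Set.mem_iInter.1 hx k) k le_rfl⟩

/-! ### Symbolic dynamics of three intervals around a repelling point. -/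

/-- Three intervals, in increasing order, such that the image of the last one covers the first one,
and the images of the other two both cover the last two; moreover the middle interval contains the
repelling centre `q`. -/
structure IsSnapBackTriple (f : ℝ → ℝ) (lo hi : Fin 3 → ℝ) (q : ℝ) : Prop where
  continuous : Continuous f
  le : ∀ i, lo i ≤ hi i
  lt₀₁ : hi 0 < lo 1
  lt₁₂ : hi 1 < lo 2
  cover : ∀ i j : Fin 3, (i = 2 ↔ j = 0) → Set.Icc (lo j) (hi j) ⊆ f '' Set.Icc (lo i) (hi i)
  abs_sub_le : ∀ x ∈ Set.Icc (lo 1) (hi 1), |x - q| ≤ 1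
  expanding : ∀ x ∈ Set.Icc (lo 1) (hi 1), 2 * |x - q| ≤ |f x - q|

namespace IsSnapBackTriple

variable {f : ℝ → ℝ} {lo hi : Fin 3 → ℝ} {q : ℝ}

theorem eq_of_mem (h : IsSnapBackTriple f lo hi q) {i j : Fin 3} {x : ℝ}
    (hi' : x ∈ Set.Icc (lo i) (hi i)) (hj : x ∈ Set.Icc (lo j) (hi j)) : i = j := by
  have h1 := h.lt₀₁
  have h2 := h.lt₁₂
  have h3 := h.le 1
  obtain ⟨h4, h5⟩ := hi'
  obtain ⟨h6, h7⟩ := hj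
  fin_cases i <;> fin_cases j <;> first | rfl | (simp at h4 h5 h6 h7; linarith)

/-- A shorter period would bring the orbit back to its starting interval at a time when the code
places it in a different, disjoint one. -/
theorem exists_minimalPeriod_eq_of_code (h : IsSnapBackTriple f lo hi q) {m : ℕ} (hm : 1 ≤ m)
    (w : ℕ → Fin 3) (hw : ∀ k, w k = 2 ↔ w (k + 1) = 0) (hwm : w m = w 0)
    (hne : ∀ k, 0 < k → k < m → w k ≠ w 0) :
    ∃ x, x ∈ Set.Icc (lo (w 0)) (hi (w 0)) ∧ Function.minimalPeriod f x = m := by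
  obtain ⟨x, hx, hxw⟩ := exists_isPeriodicPt_of_chain h.continuous (lo := lo ∘ w) (hi := hi ∘ w)
    (fun k => h.le _) m (fun k _ => h.cover _ _ (hw k)) (by simp [hwm]) (by simp [hwm])
  have hx0 : x ∈ Set.Icc (lo (w 0)) (hi (w 0)) := by simpa using hxw 0 (Nat.zero_le m)
  refine ⟨x, hx0, le_antisymm (hx.minimalPeriod_le hm) ?_⟩
  by_contra! hlt
  refine hne _ (hx.minimalPeriod_pos hm) hlt (h.eq_of_mem (x := x) ?_ hx0)
  have := hxw _ hlt.le
  rwa [Function.iterate_minimalPeriod] at this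

theorem exists_minimalPeriod_eq (h : IsSnapBackTriple f lo hi q) {m : ℕ} (hm : 1 ≤ m) :
    ∃ i, ∃ x ∈ Set.Icc (lo i) (hi i), Function.minimalPeriod f x = m := by
  rcases hm.eq_or_lt with rfl | hm2
  · exact ⟨1, h.exists_minimalPeriod_eq_of_code le_rfl (fun _ => 1) (by simp) rfl
      (fun k _ _ => by omega)⟩
  -- The excursion 2, 0 needs two distinct residues, so period 1 is handled separately by the
  -- constant code 1.
  · let w : ℕ → Fin 3 := fun k => if k % m = 0 then 2 else if k % m = 1 then 0 else 1
    refine ⟨w 0, h.exists_minimalPeriod_eq_of_code hm w (fun k => ?_) (by simp [w])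
      fun k hk hkm => ?_⟩
    · have h2 : ∀ k, w k = 2 ↔ k % m = 0 := fun k => by
        simp only [w]; split_ifs <;> simp [*]
      have h3 : ∀ k, w k = 0 ↔ k % m = 1 := fun k => by
        simp only [w]; split_ifs <;> simp [*]
      rw [h2, h3, Nat.add_mod, Nat.mod_eq_of_lt hm2]
      have hlt := Nat.mod_lt k (show m > 0 by omega)
      generalize k % m = r at hlt
      rcases (show r + 1 ≤ m from hlt).eq_or_lt with h4 | h4
      · rw [h4, Nat.mod_self]; omega
      · rw [Nat.mod_eq_of_lt h4]; omega
    · simp only [w, Nat.mod_eq_of_lt hkm, Nat.zero_mod]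
      split_ifs <;> omega

/-- The itinerary with markers at the squares: after time `m ^ 2 - 1` it makes an excursion through
the outer intervals if the bit of `α` queried by `m` is set. -/
def squareCode (α : ℕ → Bool) (t : ℕ) : Fin 3 :=
  if α (Nat.unpair (Nat.sqrt (t + 1))).1 then
    if t + 1 = Nat.sqrt (t + 1) ^ 2 then 2
    else if t + 1 = Nat.sqrt (t + 1) ^ 2 + 1 then 0 else 1
  else 1

theorem sqrt_sq_add {m r : ℕ} (hr : r ≤ 2 * m) : Nat.sqrt (m ^ 2 + r) = m := by
  rw [pow_two]
  exact Nat.sqrt_add_eq m (by omega)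

/-- Write `t + 1 = m ^ 2 + r` with `r ≤ 2 * m`. The shift by one forces `m ≥ 1`, so positions `r =
0` and `r = 1` lie in the same block and depend on the same bit; the last position of a block always
carries 1. -/
theorem squareCode_step (α : ℕ → Bool) (t : ℕ) :
    squareCode α t = 2 ↔ squareCode α (t + 1) = 0 := by
  obtain ⟨m, r, hm, hr, ht⟩ : ∃ m r, 1 ≤ m ∧ r ≤ 2 * m ∧ t + 1 = m ^ 2 + r := by
    have h1 := Nat.sqrt_le' (t + 1)
    have h2 := Nat.lt_succ_sqrt' (t + 1)
    refine ⟨Nat.sqrt (t + 1), t + 1 - Nat.sqrt (t + 1) ^ 2, Nat.sqrt_pos.2 (by omega), ?_, by omega⟩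
    have : (Nat.sqrt (t + 1)).succ ^ 2 = Nat.sqrt (t + 1) ^ 2 + 2 * Nat.sqrt (t + 1) + 1 := by
      rw [Nat.succ_eq_add_one]; ring
    omega
  unfold squareCode
  rcases hr.eq_or_lt with rfl | hr
  · have h3 : t + 1 + 1 = (m + 1) ^ 2 + 0 := by rw [ht]; ring
    rw [h3, ht, sqrt_sq_add le_rfl, sqrt_sq_add (Nat.zero_le _)]
    split_ifs <;> omega
  · have h3 : t + 1 + 1 = m ^ 2 + (r + 1) := by rw [ht]; ring
    rw [h3, ht, sqrt_sq_add hr.le, sqrt_sq_add hr]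
    split_ifs <;> omega

theorem squareCode_marker (α : ℕ → Bool) {m : ℕ} (hm : 1 ≤ m) :
    squareCode α (m ^ 2 - 1) = if α m.unpair.1 then 2 else 1 := by
  have h1 : m ^ 2 - 1 + 1 = m ^ 2 + 0 := Nat.sub_add_cancel (Nat.one_le_pow _ _ hm)
  rw [squareCode, h1, sqrt_sq_add (Nat.zero_le _)]
  simp

/-- The rest of each block does not depend on `α`: all coded orbits stay in the middle interval
together, for ever longer times. -/
theorem squareCode_block (α : ℕ → Bool) {m k : ℕ} (hk : k + 2 ≤ 2 * m) :
    squareCode α (k + (m ^ 2 + 1)) = 1 := by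
  have h1 : k + (m ^ 2 + 1) + 1 = m ^ 2 + (k + 2) := by ring
  rw [squareCode, h1, sqrt_sq_add hk]
  split_ifs <;> omega

/-- Orbits that stay long in the middle interval start close to the repelling centre. -/
theorem abs_sub_le_pow (h : IsSnapBackTriple f lo hi q) (N : ℕ) {x : ℝ}
    (hx : ∀ k ≤ N, f^[k] x ∈ Set.Icc (lo 1) (hi 1)) : |x - q| ≤ (1 / 2) ^ N := by
  induction N generalizing x with
  | zero => simpa using h.abs_sub_le x (by simpa using hx 0 le_rfl)
  | succ N ih =>
    have h1 := ih (x := f x) fun k hk => by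
      rw [← Function.iterate_succ_apply]; exact hx _ (by omega)
    have h2 := h.expanding x (by simpa using hx 0 (by omega))
    rw [pow_succ]
    linarith

/-- Long common stays in the middle interval put both orbits close to `q`, so the liminf vanishes. A
bit where the codes differ is queried infinitely often, and at those markers one orbit is in the
last interval and the other in the middle one. -/
theorem isLiYorkePair_of_code (h : IsSnapBackTriple f lo hi q) {α β : ℕ → Bool} (hne : α ≠ β)
    {x y : ℝ}
    (hx : ∀ k, f^[k] x ∈ Set.Icc (lo (squareCode α k)) (hi (squareCode α k)))
    (hy : ∀ k, f^[k] y ∈ Set.Icc (lo (squareCode β k)) (hi (squareCode β k))) :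
    IsLiYorkePair f x y := by
  constructor
  · have key : ∀ N : ℕ, liminf (fun t : ℕ => edist (f^[t] x) (f^[t] y)) atTop ≤
        ENNReal.ofReal (2 * (1 / 2) ^ N) := by
      intro N
      refine liminf_le_of_frequently_le' (frequently_atTop.2 fun T => ?_)
      let m := T + N + 1
      have hT : T ≤ m ^ 2 + 1 := by
        have : m ≤ m ^ 2 := Nat.le_self_pow (by norm_num) m
        omega
      refine ⟨m ^ 2 + 1, hT, ?_⟩
      have h1 := h.abs_sub_le_pow N (x := f^[m ^ 2 + 1] x) fun k hk => by
        have := hx (k + (m ^ 2 + 1))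
        rwa [squareCode_block α (by omega), Function.iterate_add_apply] at this
      have h2 := h.abs_sub_le_pow N (x := f^[m ^ 2 + 1] y) fun k hk => by
        have := hy (k + (m ^ 2 + 1))
        rwa [squareCode_block β (by omega), Function.iterate_add_apply] at this
      rw [edist_dist]
      refine ENNReal.ofReal_le_ofReal ?_
      rw [Real.dist_eq]
      have h3 := _root_.abs_sub_le (f^[m ^ 2 + 1] x) q (f^[m ^ 2 + 1] y)
      rw [abs_sub_comm q] at h3
      linarith
    have hlim : Tendsto (fun N : ℕ => ENNReal.ofReal (2 * (1 / 2) ^ N)) atTop (nhds 0) := by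
      rw [← ENNReal.ofReal_zero]
      refine ENNReal.tendsto_ofReal ?_
      simpa using (tendsto_pow_atTop_nhds_zero_of_lt_one (r := (1 / 2 : ℝ)) (by norm_num)
        (by norm_num)).const_mul 2
    exact le_antisymm (ge_of_tendsto' hlim key) bot_le
  · obtain ⟨j, hj⟩ := Function.ne_iff.1 hne
    have hgap : 0 < lo 2 - hi 1 := sub_pos.2 h.lt₁₂
    refine (ENNReal.ofReal_pos.2 hgap).trans_le
      (le_limsup_of_frequently_le' (frequently_atTop.2 fun T => ?_))
    -- Arbitrarily large blocks query bit `j`.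
    let m := Nat.pair j (T + 1)
    have hm : T + 1 ≤ m := Nat.right_le_pair _ _
    have hT : T ≤ m ^ 2 - 1 := by
      have : m ≤ m ^ 2 := Nat.le_self_pow (by norm_num) m
      omega
    refine ⟨m ^ 2 - 1, hT, ?_⟩
    have h1 := hx (m ^ 2 - 1)
    have h2 := hy (m ^ 2 - 1)
    rw [squareCode_marker _ (by omega), show m.unpair.1 = j by simp [m]] at h1 h2
    rw [edist_dist, Real.dist_eq]
    refine ENNReal.ofReal_le_ofReal ?_
    rw [le_abs]
    cases hα : α j <;> cases hβ : β j <;> simp [hα, hβ] at h1 h2 hj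
    · right; linarith [h1.2, h2.1]
    · left; linarith [h1.1, h2.2]

/-- Distinct codes give Li–Yorke pairs, in particular distinct points, so the scrambled set is as
large as `ℕ → Bool`. -/
theorem exists_scrambled (h : IsSnapBackTriple f lo hi q) :
    ∃ S : Set ℝ, (∀ x ∈ S, ∃ i, x ∈ Set.Icc (lo i) (hi i)) ∧ ¬ S.Countable ∧
      S.Pairwise (IsLiYorkePair f) := by
  choose x hx using fun α : ℕ → Bool =>
    exists_forall_iterate_mem_of_chain h.continuous (lo := lo ∘ squareCode α)
      (hi := hi ∘ squareCode α) (fun k => h.le _) fun k => h.cover _ _ (squareCode_step α k)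
  have hpair : ∀ α β, α ≠ β → IsLiYorkePair f (x α) (x β) := fun α β hne =>
    h.isLiYorkePair_of_code hne (hx α) (hx β)
  have hinj : Function.Injective x := by
    intro α β hαβ
    by_contra hne
    have := (hpair α β hne).2
    simp [hαβ] at this
  refine ⟨Set.range x, ?_, ?_, ?_⟩
  · rintro _ ⟨α, rfl⟩
    exact ⟨_, by simpa using hx α 0⟩
  · intro hc
    have : Countable (ℕ → Bool) := by
      rw [← Set.countable_univ_iff]
      exact Set.countable_of_injective_of_countable_image hinj.injOn (by rwa [Set.image_univ])
    obtain ⟨g, hg⟩ := exists_injective_nat (ℕ → Bool)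
    classical
    exact Function.cantor_injective (fun s : Set ℕ => g fun k => decide (k ∈ s))
      fun s t hst => by ext k; simpa using congrFun (hg hst) k
  · rintro _ ⟨α, rfl⟩ _ ⟨β, rfl⟩ hne
    exact hpair α β fun hαβ => hne (by rw [hαβ])

end IsSnapBackTriple

/-! ### The exponential weights map of the interval -/

/-- The exponential weights update on the weight `p` of the first of two alternatives, when the
excess loss of the first one is `c * (p - q)`. -/
noncomputable def expWeights (c q p : ℝ) : ℝ := p / (p + (1 - p) * Real.exp (c * (p - q)))

/-- `expWeights` on `[0, 1]`, extended by constants to the real line. -/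
noncomputable def expWeightsExtend (c q : ℝ) : ℝ → ℝ :=
  Set.IccExtend (zero_le_one' ℝ) fun p : Set.Icc (0 : ℝ) 1 => expWeights c q p

theorem expWeights_denom_pos (c q : ℝ) {p : ℝ} (h0 : 0 ≤ p) (h1 : p ≤ 1) :
    0 < p + (1 - p) * Real.exp (c * (p - q)) := by
  rcases h0.eq_or_lt with rfl | h0
  · simpa using Real.exp_pos _
  · have := mul_nonneg (sub_nonneg.2 h1) (Real.exp_pos (c * (p - q))).le
    linarith

/-- Comparison of odds with the denominators cleared, so that boundary values need no separate
treatment. -/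
theorem le_expWeights_iff (c q : ℝ) {p y : ℝ} (h0 : 0 ≤ p) (h1 : p ≤ 1) :
    y ≤ expWeights c q p ↔ y * ((1 - p) * Real.exp (c * (p - q))) ≤ p * (1 - y) := by
  rw [expWeights, le_div_iff₀ (expWeights_denom_pos c q h0 h1)]
  constructor <;> intro h <;> linarith

theorem expWeights_le_iff (c q : ℝ) {p y : ℝ} (h0 : 0 ≤ p) (h1 : p ≤ 1) :
    expWeights c q p ≤ y ↔ p * (1 - y) ≤ y * ((1 - p) * Real.exp (c * (p - q))) := by
  rw [expWeights, div_le_iff₀ (expWeights_denom_pos c q h0 h1)]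
  constructor <;> intro h <;> linarith

theorem expWeights_mem_Icc (c q : ℝ) {p : ℝ} (hp : p ∈ Set.Icc (0 : ℝ) 1) :
    expWeights c q p ∈ Set.Icc (0 : ℝ) 1 := by
  constructor
  · rw [le_expWeights_iff c q hp.1 hp.2]
    simpa using hp.1
  · rw [expWeights_le_iff c q hp.1 hp.2]
    simpa using mul_nonneg (sub_nonneg.2 hp.2) (Real.exp_pos _).le

theorem one_sub_expWeights (c q : ℝ) {p : ℝ} (hp : p ∈ Set.Icc (0 : ℝ) 1) :
    1 - expWeights c q p =
      (1 - p) * Real.exp (c * (p - q)) / (p + (1 - p) * Real.exp (c * (p - q))) := by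
  have := (expWeights_denom_pos c q hp.1 hp.2).ne'
  rw [expWeights, eq_div_iff this, sub_mul, div_mul_cancel₀ _ this]
  ring

theorem expWeightsExtend_of_mem (c q : ℝ) {p : ℝ} (hp : p ∈ Set.Icc (0 : ℝ) 1) :
    expWeightsExtend c q p = expWeights c q p :=
  Set.IccExtend_of_mem _ (fun p : Set.Icc (0 : ℝ) 1 => expWeights c q p) hp

theorem expWeightsExtend_mem_Icc (c q p : ℝ) : expWeightsExtend c q p ∈ Set.Icc (0 : ℝ) 1 :=
  expWeights_mem_Icc c q (Set.projIcc (0 : ℝ) 1 zero_le_one p).2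

theorem continuous_expWeightsExtend (c q : ℝ) : Continuous (expWeightsExtend c q) := by
  refine Continuous.Icc_extend' ?_
  unfold expWeights
  refine Continuous.div (by fun_prop) (by fun_prop) fun p => ?_
  exact (expWeights_denom_pos c q p.2.1 p.2.2).ne'

/-- The odds factors of two successive steps multiply, so their exponents add. -/
theorem le_expWeights_expWeights_iff (c q : ℝ) {p y : ℝ} (hp : p ∈ Set.Icc (0 : ℝ) 1) :
    y ≤ expWeights c q (expWeights c q p) ↔
      y * ((1 - p) * Real.exp (c * (p + expWeights c q p - 2 * q))) ≤ p * (1 - y) := by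
  have hD := expWeights_denom_pos c q hp.1 hp.2
  have hF := expWeights_mem_Icc c q hp
  rw [le_expWeights_iff c q hF.1 hF.2, one_sub_expWeights c q hp,
    show c * (p + expWeights c q p - 2 * q) = c * (p - q) + c * (expWeights c q p - q) by ring,
    Real.exp_add]
  generalize Real.exp (c * (expWeights c q p - q)) = Y
  rw [expWeights]
  rw [← mul_le_mul_iff_left₀ hD]
  have h1 : ∀ u v w : ℝ, v * (u / w * Y) * w = v * (u * Y) * (w / w) := fun u v w => by ring
  have h2 : ∀ u v w : ℝ, u / w * v * w = u * v * (w / w) := fun u v w => by ring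
  rw [h1, h2, div_self hD.ne', mul_one, mul_one]
  ring_nf

theorem expWeights_expWeights_le_iff (c q : ℝ) {p y : ℝ} (hp : p ∈ Set.Icc (0 : ℝ) 1) :
    expWeights c q (expWeights c q p) ≤ y ↔
      p * (1 - y) ≤ y * ((1 - p) * Real.exp (c * (p + expWeights c q p - 2 * q))) := by
  have hD := expWeights_denom_pos c q hp.1 hp.2
  have hF := expWeights_mem_Icc c q hp
  rw [expWeights_le_iff c q hF.1 hF.2, one_sub_expWeights c q hp,
    show c * (p + expWeights c q p - 2 * q) = c * (p - q) + c * (expWeights c q p - q) by ring,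
    Real.exp_add]
  generalize Real.exp (c * (expWeights c q p - q)) = Y
  rw [expWeights]
  rw [← mul_le_mul_iff_left₀ hD]
  have h1 : ∀ u v w : ℝ, v * (u / w * Y) * w = v * (u * Y) * (w / w) := fun u v w => by ring
  have h2 : ∀ u v w : ℝ, u / w * v * w = u * v * (w / w) := fun u v w => by ring
  rw [h1, h2, div_self hD.ne', mul_one, mul_one]
  ring_nf

/-- The fixed point `q` is repelling. -/
theorem two_mul_abs_sub_le_expWeights {c q κ x : ℝ} (hκ : 0 < κ) (hq : κ ≤ q) (hq' : q ≤ 1 / 2 - κ)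
    (hc : 24 ≤ c * κ) (hx : |x - q| ≤ κ / 4) : 2 * |x - q| ≤ |expWeights c q x - q| := by
  obtain ⟨hx1, hx2⟩ := abs_le.1 hx
  have hx0 : 0 ≤ x := by linarith
  have hx1' : x ≤ 1 := by linarith
  have hexp := Real.add_one_le_exp (c * (x - q))
  rcases le_total 0 (x - q) with hz | hz
  · rw [abs_of_nonneg hz]
    refine le_trans ?_ (neg_le_abs _)
    suffices expWeights c q x ≤ q - 2 * (x - q) by linarith
    rw [expWeights_le_iff c q hx0 hx1']
    -- With `y = q - 2 (x - q)` the odds inequality reads `x - y = 3 (x - q) ≤ (1 - x) y (E - 1)`,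
    -- and `E - 1 ≥ c (x - q)`.
    have h1 : κ / 4 ≤ (1 - x) * (q - 2 * (x - q)) := by nlinarith
    have h2 : 3 * (x - q) ≤ κ / 4 * (c * (x - q)) := by nlinarith
    have h3 : κ / 4 * (c * (x - q)) ≤
        (1 - x) * (q - 2 * (x - q)) * (Real.exp (c * (x - q)) - 1) :=
      mul_le_mul h1 (by linarith) (by nlinarith) (by linarith)
    linarith
  · rw [abs_of_nonpos hz]
    refine le_trans ?_ (le_abs_self _)
    suffices q + 2 * (q - x) ≤ expWeights c q x by linarith
    rw [le_expWeights_iff c q hx0 hx1']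
    have hexp' := Real.add_one_le_exp (-(c * (x - q)))
    have hmul : Real.exp (c * (x - q)) * Real.exp (-(c * (x - q))) = 1 := by
      rw [← Real.exp_add]; simp
    have hpos := Real.exp_pos (c * (x - q))
    set G := Real.exp (-(c * (x - q)))
    set E := Real.exp (c * (x - q))
    -- Mirror image, after multiplying by the inverse exponential `G`. The weaker bound `κ / 8` is
    -- what calls for `c * κ ≥ 24 = 3 * 8`.
    have h1 : κ / 8 ≤ x * (1 - q - 2 * (q - x)) := by nlinarith
    have h2 : 3 * (q - x) ≤ κ / 8 * (c * (q - x)) := by nlinarith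
    have h3 : κ / 8 * (c * (q - x)) ≤ x * (1 - q - 2 * (q - x)) * (G - 1) :=
      mul_le_mul h1 (by linarith) (by nlinarith) (by linarith)
    have h4 : (q + 2 * (q - x)) * (1 - x) ≤ x * (1 - q - 2 * (q - x)) * G := by linarith
    have h5 := mul_le_mul_of_nonneg_left h4 hpos.le
    calc _ = E * ((q + 2 * (q - x)) * (1 - x)) := by ring
      _ ≤ E * (x * (1 - q - 2 * (q - x)) * G) := h5
      _ = E * G * (x * (1 - q - 2 * (q - x))) := by ring
      _ = _ := by rw [hmul]; ring

theorem exists_isSnapBackTriple_of_le {c q κ : ℝ} (hκ : 0 < κ) (hq : κ ≤ q) (hq' : q ≤ 1 / 2 - κ)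
    (hc : 24 ≤ c * κ) (hG : 4 ≤ κ ^ 2 * Real.exp (c * (κ / 8))) :
    ∃ lo hi, IsSnapBackTriple (expWeightsExtend c q) lo hi q ∧ ∀ i, 0 ≤ lo i ∧ hi i ≤ 1 := by
  have hc0 : 0 ≤ c := by nlinarith
  have hκ4 : κ ≤ 1 / 4 := by linarith
  set G := Real.exp (c * (κ / 8)) with hGdef
  have hG0 : 0 < G := Real.exp_pos _
  have hle : ∀ t, κ / 8 ≤ t → G ≤ Real.exp (c * t) := fun t ht =>
    Real.exp_le_exp.2 (mul_le_mul_of_nonneg_left ht hc0)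
  have hle' : ∀ t, t ≤ -(κ / 8) → Real.exp (c * t) ≤ κ ^ 2 / 4 := fun t ht => by
    have h1 : Real.exp (c * t) ≤ Real.exp (-(c * (κ / 8))) :=
      Real.exp_le_exp.2 (by nlinarith)
    rw [Real.exp_neg, ← hGdef] at h1
    refine h1.trans ?_
    rw [inv_le_iff_one_le_mul₀ hG0]
    linarith
  have hκG : 4 ≤ κ * G := by nlinarith [mul_pos hκ hG0]
  have hm : ∀ x, 0 ≤ x → x ≤ 1 → x ∈ Set.Icc (0 : ℝ) 1 := fun x h h' => ⟨h, h'⟩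
  have hu := hm (2 * q + κ / 4) (by linarith) (by linarith)
  have hv := hm (2 * q - κ / 4) (by linarith) (by linarith)
  have ha := expWeights_mem_Icc c q hu
  have hb := expWeights_mem_Icc c q hv
  -- This bound keeps the two-step exponent below `-c κ / 8` at `2q - κ / 4`.
  have hb' : expWeights c q (2 * q - κ / 4) ≤ κ / 8 := by
    rw [expWeights_le_iff c q hv.1 hv.2]
    have h1 := hle (2 * q - κ / 4 - q) (by linarith)
    have h2 : 2 * κ * G ≤ (1 - (2 * q - κ / 4)) * Real.exp (c * (2 * q - κ / 4 - q)) :=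
      mul_le_mul (by linarith) h1 hG0.le (by linarith)
    nlinarith [hv.1, hv.2]
  -- The odds at the two points differ by a factor of at most `1 / κ ^ 2`, which the extra `exp (c κ
  -- / 2) ≥ 4 / κ ^ 2` outweighs.
  have hab : expWeights c q (2 * q + κ / 4) ≤ expWeights c q (2 * q - κ / 4) := by
    rw [expWeights_le_iff c q hu.1 hu.2, one_sub_expWeights c q hv, expWeights, mul_div_assoc',
      div_mul_eq_mul_div]
    refine div_le_div_of_nonneg_right ?_ (expWeights_denom_pos c q hv.1 hv.2).le
    have h1 : Real.exp (c * (2 * q + κ / 4 - q)) =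
        Real.exp (c * (2 * q - κ / 4 - q)) * Real.exp (c * (κ / 2)) := by
      rw [← Real.exp_add]; congr 1; ring
    have h2 := hle (κ / 2) (by linarith)
    have hpos := Real.exp_pos (c * (2 * q - κ / 4 - q))
    rw [h1]
    generalize Real.exp (c * (2 * q - κ / 4 - q)) = X at *
    have h3 : (2 * q + κ / 4) * (1 - (2 * q - κ / 4)) ≤ 1 := by nlinarith [hu.1, hv.1, hv.2, hu.2]
    have h4 : κ * κ ≤ (2 * q - κ / 4) * (1 - (2 * q + κ / 4)) :=
      mul_le_mul (by linarith) (by linarith) hκ.le (by linarith)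
    have h5 : κ * κ * G ≤
        (2 * q - κ / 4) * (1 - (2 * q + κ / 4)) * Real.exp (c * (κ / 2)) :=
      mul_le_mul h4 h2 hG0.le (by nlinarith)
    have h6 : (2 * q + κ / 4) * (1 - (2 * q - κ / 4)) ≤
        (2 * q - κ / 4) * (1 - (2 * q + κ / 4)) * Real.exp (c * (κ / 2)) := by nlinarith
    have h7 := mul_le_mul_of_nonneg_left h6 hpos.le
    linarith
  have hFa : expWeights c q (expWeights c q (2 * q + κ / 4)) ≤ κ / 2 := by
    rw [expWeights_expWeights_le_iff c q hu]
    have h1 := hle (2 * q + κ / 4 + expWeights c q (2 * q + κ / 4) - 2 * q) (by linarith [ha.1])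
    have h2 : κ * G ≤ (1 - (2 * q + κ / 4)) *
        Real.exp (c * (2 * q + κ / 4 + expWeights c q (2 * q + κ / 4) - 2 * q)) :=
      mul_le_mul (by linarith) h1 hG0.le (by linarith)
    nlinarith [hu.1, hu.2]
  have hFb : 1 - κ ≤ expWeights c q (expWeights c q (2 * q - κ / 4)) := by
    rw [le_expWeights_expWeights_iff c q hv]
    have h1 := hle' (2 * q - κ / 4 + expWeights c q (2 * q - κ / 4) - 2 * q) (by linarith)
    have h2 : (1 - (2 * q - κ / 4)) *
        Real.exp (c * (2 * q - κ / 4 + expWeights c q (2 * q - κ / 4) - 2 * q)) ≤ 1 * (κ ^ 2 / 4) :=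
      mul_le_mul (by linarith) h1 (Real.exp_pos _).le zero_le_one
    nlinarith
  have hFr : expWeights c q (q + κ / 4) ≤ κ / 2 := by
    rw [expWeights_le_iff c q (by linarith) (by linarith)]
    have h1 := hle (q + κ / 4 - q) (by linarith)
    have h2 : 1 / 2 * G ≤ (1 - (q + κ / 4)) * Real.exp (c * (q + κ / 4 - q)) :=
      mul_le_mul (by linarith) h1 hG0.le (by linarith)
    nlinarith
  have hFl : 1 - κ ≤ expWeights c q (q - κ / 4) := by
    rw [le_expWeights_iff c q (by linarith) (by linarith)]
    have h1 := hle' (q - κ / 4 - q) (by linarith)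
    have h2 : (1 - (q - κ / 4)) * Real.exp (c * (q - κ / 4 - q)) ≤ 1 * (κ ^ 2 / 4) :=
      mul_le_mul (by linarith) h1 (Real.exp_pos _).le zero_le_one
    nlinarith
  have hcont := continuous_expWeightsExtend c q
  rw [← expWeightsExtend_of_mem c q (hm _ (by linarith) (by linarith))] at hFr hFl
  rw [← expWeightsExtend_of_mem c q ha] at hFa
  rw [← expWeightsExtend_of_mem c q hb] at hFb
  refine ⟨![expWeights c q (2 * q + κ / 4), q - κ / 4, 2 * q - κ / 4],
    ![expWeights c q (2 * q - κ / 4), q + κ / 4, 2 * q + κ / 4],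
    ⟨hcont, ?_, ?_, ?_, ?_, ?_, ?_⟩, ?_⟩
  · intro i
    fin_cases i <;> simp
    · exact hab
    all_goals linarith
  · simp; linarith
  · simp; linarith
  · have h0 : Set.Icc (κ / 2) (1 - κ) ⊆ expWeightsExtend c q ''
        Set.Icc (expWeights c q (2 * q + κ / 4)) (expWeights c q (2 * q - κ / 4)) :=
      (Set.Icc_subset_Icc hFa hFb).trans (intermediate_value_Icc hab hcont.continuousOn)
    have h1 : Set.Icc (κ / 2) (1 - κ) ⊆ expWeightsExtend c q ''
        Set.Icc (q - κ / 4) (q + κ / 4) :=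
      (Set.Icc_subset_Icc hFr hFl).trans
        (intermediate_value_Icc' (by linarith) hcont.continuousOn)
    have h2 : Set.Icc (expWeights c q (2 * q + κ / 4)) (expWeights c q (2 * q - κ / 4)) ⊆
        expWeightsExtend c q '' Set.Icc (2 * q - κ / 4) (2 * q + κ / 4) := by
      rw [← expWeightsExtend_of_mem c q hu, ← expWeightsExtend_of_mem c q hv]
      exact intermediate_value_Icc' (by linarith) hcont.continuousOn
    have h3 : Set.Icc (q - κ / 4) (q + κ / 4) ⊆ Set.Icc (κ / 2) (1 - κ) :=
      Set.Icc_subset_Icc (by linarith) (by linarith)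
    have h4 : Set.Icc (2 * q - κ / 4) (2 * q + κ / 4) ⊆ Set.Icc (κ / 2) (1 - κ) :=
      Set.Icc_subset_Icc (by linarith) (by linarith)
    intro i j hij
    fin_cases i <;> fin_cases j <;> simp at hij
    · exact h3.trans h0
    · exact h4.trans h0
    · exact h3.trans h1
    · exact h4.trans h1
    · exact h2
  · rintro x ⟨hx1, hx2⟩
    simp at hx1 hx2
    rw [abs_le]
    constructor <;> linarith
  · rintro x ⟨hx1, hx2⟩
    simp at hx1 hx2
    rw [expWeightsExtend_of_mem c q (hm x (by linarith) (by linarith))]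
    exact two_mul_abs_sub_le_expWeights hκ hq hq' hc
      (abs_le.2 ⟨by linarith, by linarith⟩)
  · intro i
    fin_cases i <;> simp
    · exact ⟨ha.1, hb.2⟩
    all_goals constructor <;> linarith

/-- If `q` stays away from `0` and from `1 / 2` on the left, the exponential weights map is chaotic
for all large intensities. -/
theorem exists_isSnapBackTriple {κ : ℝ} (hκ : 0 < κ) : ∃ C, ∀ c q, C ≤ c → κ ≤ q →
    q ≤ 1 / 2 - κ → ∃ lo hi, IsSnapBackTriple (expWeightsExtend c q) lo hi q ∧
      ∀ i, 0 ≤ lo i ∧ hi i ≤ 1 := by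
  -- The first term gives `24 ≤ c * κ`; the second gives `κ ^ 2 * (c * κ / 8) ≥ 4`, enough because
  -- `exp x ≥ x`.
  refine ⟨24 / κ + 32 / κ ^ 3, fun c q hc hq hq' =>
    exists_isSnapBackTriple_of_le hκ hq hq' ?_ ?_⟩
  · have : 24 / κ ≤ c := by
      have : 0 < 32 / κ ^ 3 := by positivity
      linarith
    exact (div_le_iff₀ hκ).1 this
  · have : 32 / κ ^ 3 ≤ c := by
      have : 0 < 24 / κ := by positivity
      linarith
    rw [div_le_iff₀ (by positivity)] at this
    have h2 := Real.add_one_le_exp (c * (κ / 8))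
    have h3 := mul_le_mul_of_nonneg_left h2 (sq_nonneg κ)
    nlinarith [sq_nonneg κ]

/-! ### Transfer along isometric semiconjugacies -/

section Transfer

variable {X Y : Type*} [MetricSpace X] [MetricSpace Y] {f : X → X} {g : Y → Y} {h : X → Y}
  {s : Set X}

/-- Isometry is asked only on an invariant set: `weightPoint` clamps, hence is not injective on all
of ℝ. -/
theorem IsLiYorkePair.of_semiconj (hs : Set.MapsTo f s s) (hh : Function.Semiconj h f g)
    (hiso : ∀ x ∈ s, ∀ y ∈ s, edist (h x) (h y) = edist x y) {x y : X} (hx : x ∈ s) (hy : y ∈ s)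
    (hxy : IsLiYorkePair f x y) : IsLiYorkePair g (h x) (h y) := by
  have key : (fun t : ℕ => edist (g^[t] (h x)) (g^[t] (h y))) =
      fun t : ℕ => edist (f^[t] x) (f^[t] y) := by
    funext t
    rw [← (hh.iterate_right t).eq, ← (hh.iterate_right t).eq]
    exact hiso _ (hs.iterate t hx) _ (hs.iterate t hy)
  unfold IsLiYorkePair
  rw [key]
  exact hxy

theorem injOn_of_edist_eq (hiso : ∀ x ∈ s, ∀ y ∈ s, edist (h x) (h y) = edist x y) :
    Set.InjOn h s := fun x hx y hy hxy => by
  rw [← edist_eq_zero, ← hiso x hx y hy, hxy, edist_self]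

theorem isLiYorkeChaotic_of_semiconj (hs : Set.MapsTo f s s) (hh : Function.Semiconj h f g)
    (hiso : ∀ x ∈ s, ∀ y ∈ s, edist (h x) (h y) = edist x y) {S : Set X} (hS : S ⊆ s)
    (hunc : ¬ S.Countable) (hpair : S.Pairwise (IsLiYorkePair f)) : IsLiYorkeChaotic g := by
  refine ⟨h '' S, fun hc => hunc ?_, ?_⟩
  · exact Set.countable_of_injective_of_countable_image ((injOn_of_edist_eq hiso).mono hS) hc
  · rintro _ ⟨x, hx, rfl⟩ _ ⟨y, hy, rfl⟩ hne
    exact (hpair hx hy fun hxy => hne (by rw [hxy])).of_semiconj hs hh hiso (hS hx) (hS hy)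

theorem minimalPeriod_of_semiconj (hs : Set.MapsTo f s s) (hh : Function.Semiconj h f g)
    (hiso : ∀ x ∈ s, ∀ y ∈ s, edist (h x) (h y) = edist x y) {x : X} (hx : x ∈ s) :
    Function.minimalPeriod g (h x) = Function.minimalPeriod f x := by
  rw [Function.minimalPeriod_eq_minimalPeriod_iff]
  intro t
  unfold Function.IsPeriodicPt Function.IsFixedPt
  rw [← (hh.iterate_right t).eq]
  exact (injOn_of_edist_eq hiso).eq_iff (hs.iterate t hx) hx

end Transfer

/-! ### The gradient of the decoupled performative loss -/

namespace LocationScaleMap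

variable {d n : ℕ} (M : LocationScaleMap d n)

theorem A_symm (k l : Fin d) : M.A k l = M.A l k := by
  simp [A, mul_comm]

theorem A_diag_nonneg (k : Fin d) : 0 ≤ M.A k k :=
  integral_nonneg fun z => mul_self_nonneg (z.1 k)

/-- The residual is `⟨w, x⟩ + x₀`; finite second moments make every term of its expanded square
integrable. -/
theorem loss_eq (θ : Fin n → Fin d → ℝ) (θ' : Fin d → ℝ) {w : Fin d → ℝ}
    (hw : w = M.θ₀ - ∑ i, M.influence i • θ i - θ') :
    M.loss θ θ' = w ⬝ᵥ (M.A.mulVec w) + 2 * (w ⬝ᵥ fun k => ∫ z, z.2 * z.1 k ∂M.law) +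
      ∫ z, z.2 * z.2 ∂M.law := by
  have hint : ∀ k l, Integrable (fun z : (Fin d → ℝ) × ℝ => z.1 k * z.1 l) M.law := fun k l =>
    (M.memLp_feature k).integrable_mul (M.memLp_feature l)
  have hint' : ∀ k, Integrable (fun z : (Fin d → ℝ) × ℝ => z.2 * z.1 k) M.law := fun k =>
    M.memLp_noise.integrable_mul (M.memLp_feature k)
  have hint'' : Integrable (fun z : (Fin d → ℝ) × ℝ => z.2 * z.2) M.law :=
    M.memLp_noise.integrable_mul M.memLp_noise
  have h1 : ∀ z : (Fin d → ℝ) × ℝ,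
      ((M.θ₀ - ∑ i, M.influence i • θ i) ⬝ᵥ z.1 + z.2 - θ' ⬝ᵥ z.1) ^ 2 =
        (∑ k, ∑ l, w k * w l * (z.1 k * z.1 l)) + (∑ k, 2 * w k * (z.2 * z.1 k)) + z.2 * z.2 := by
    intro z
    have h2 : (M.θ₀ - ∑ i, M.influence i • θ i) ⬝ᵥ z.1 + z.2 - θ' ⬝ᵥ z.1 = w ⬝ᵥ z.1 + z.2 := by
      rw [hw, sub_dotProduct _ θ']; ring
    have h3 : (∑ k, ∑ l, w k * w l * (z.1 k * z.1 l)) = (w ⬝ᵥ z.1) * (w ⬝ᵥ z.1) := by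
      rw [dotProduct, Finset.sum_mul_sum]
      exact Finset.sum_congr rfl fun k _ => Finset.sum_congr rfl fun l _ => by ring
    have h4 : (∑ k, 2 * w k * (z.2 * z.1 k)) = 2 * z.2 * (w ⬝ᵥ z.1) := by
      rw [dotProduct, Finset.mul_sum]
      exact Finset.sum_congr rfl fun k _ => by ring
    rw [h2, h3, h4]; ring
  unfold loss distribution
  rw [integral_map (by fun_prop) (by fun_prop)]
  simp only [h1]
  have hint₃ : ∀ k, Integrable (fun z : (Fin d → ℝ) × ℝ => ∑ l, w k * w l * (z.1 k * z.1 l)) M.law :=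
    fun k => integrable_finsetSum _ fun l _ => (hint k l).const_mul _
  have hint₄ : Integrable (fun z : (Fin d → ℝ) × ℝ => ∑ k, ∑ l, w k * w l * (z.1 k * z.1 l)) M.law :=
    integrable_finsetSum _ fun k _ => hint₃ k
  have hint₅ : Integrable (fun z : (Fin d → ℝ) × ℝ => ∑ k, 2 * w k * (z.2 * z.1 k)) M.law :=
    integrable_finsetSum _ fun k _ => (hint' k).const_mul _
  rw [integral_add (f := fun z => _ + _) (hint₄.add hint₅) hint'', integral_add hint₄ hint₅,
    integral_finsetSum _ fun k _ => hint₃ k,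
    integral_finsetSum _ fun k _ => (hint' k).const_mul _]
  congr 2
  · rw [dotProduct]
    refine Finset.sum_congr rfl fun k _ => ?_
    rw [integral_finsetSum _ fun l _ => (hint k l).const_mul _, Matrix.mulVec, dotProduct,
      Finset.mul_sum]
    refine Finset.sum_congr rfl fun l _ => ?_
    rw [integral_const_mul, A, Matrix.of_apply]
    ring
  · rw [dotProduct, Finset.mul_sum]
    refine Finset.sum_congr rfl fun k _ => ?_
    rw [integral_const_mul]
    ring

/-- Along a coordinate line the loss is a quadratic polynomial in the parameter; symmetry of `A`
merges its two cross terms. -/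
theorem grad_eq (θ : Fin n → Fin d → ℝ) (θ' : Fin d → ℝ) :
    M.grad θ θ' = fun k => 2 * M.A.mulVec (∑ i, M.influence i • θ i + θ') k - 2 * M.b k := by
  funext k
  set v := M.θ₀ - ∑ i, M.influence i • θ i with hv
  set e : Fin d → ℝ := fun k => ∫ z, z.2 * z.1 k ∂M.law with he
  have hloss : M.loss θ = fun θ' => (v - θ') ⬝ᵥ (M.A.mulVec (v - θ')) + 2 * ((v - θ') ⬝ᵥ e) +
      ∫ z, z.2 * z.2 ∂M.law := funext fun θ' => M.loss_eq θ θ' rfl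
  have hdiff : DifferentiableAt ℝ (M.loss θ) θ' := by
    rw [hloss]
    simp only [dotProduct, Matrix.mulVec, Pi.sub_apply]
    fun_prop
  rw [grad, ← hdiff.lineDeriv_eq_fderiv, lineDeriv, hloss]
  have hline : ∀ t : ℝ, (v - (θ' + t • Pi.single k 1)) ⬝ᵥ
        (M.A.mulVec (v - (θ' + t • Pi.single k 1))) +
        2 * ((v - (θ' + t • Pi.single k 1)) ⬝ᵥ e) + ∫ z, z.2 * z.2 ∂M.law =
      M.A k k * t ^ 2 + (-2 * M.A.mulVec (v - θ') k - 2 * e k) * t +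
        ((v - θ') ⬝ᵥ (M.A.mulVec (v - θ')) + 2 * ((v - θ') ⬝ᵥ e) + ∫ z, z.2 * z.2 ∂M.law) := by
    intro t
    rw [← sub_sub]
    generalize v - θ' = u
    have h1 : u ⬝ᵥ M.A.mulVec (Pi.single k 1) = M.A.mulVec u k := by
      rw [Matrix.mulVec_single_one, Matrix.mulVec, dotProduct, dotProduct]
      exact Finset.sum_congr rfl fun l _ => by
        rw [Matrix.col_apply, M.A_symm l k, mul_comm]
    have h2 : M.A.mulVec (Pi.single k 1) k = M.A k k := by
      rw [Matrix.mulVec_single_one, Matrix.col_apply]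
    rw [Matrix.mulVec_sub, Matrix.mulVec_smul]
    simp only [sub_dotProduct, dotProduct_sub, smul_dotProduct, dotProduct_smul, smul_eq_mul]
    rw [h1, single_one_dotProduct, single_one_dotProduct, single_one_dotProduct, h2]
    ring
  simp only [hline]
  have hd : HasDerivAt (fun t : ℝ => M.A k k * t ^ 2 +
      (-2 * M.A.mulVec (v - θ') k - 2 * e k) * t +
        ((v - θ') ⬝ᵥ (M.A.mulVec (v - θ')) + 2 * ((v - θ') ⬝ᵥ e) + ∫ z, z.2 * z.2 ∂M.law))
      (-2 * M.A.mulVec (v - θ') k - 2 * e k) 0 := by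
    have h := (((hasDerivAt_pow 2 (0 : ℝ)).const_mul (M.A k k)).add
      ((hasDerivAt_id (0 : ℝ)).const_mul (-2 * M.A.mulVec (v - θ') k - 2 * e k))).add_const
        ((v - θ') ⬝ᵥ (M.A.mulVec (v - θ')) + 2 * ((v - θ') ⬝ᵥ e) + ∫ z, z.2 * z.2 ∂M.law)
    simpa using h
  rw [hd.deriv, b, ← he, hv, sub_sub, Matrix.mulVec_sub]
  simp only [Pi.sub_apply, Pi.add_apply]
  ring

end LocationScaleMap

/-! ### Symmetric profiles -/

/-- The point of the simplex with weight `p` (clamped to `[0, 1]`) at `k₀`. -/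
noncomputable def weightPoint (k₀ : Fin 2) (p : ℝ) : stdSimplex ℝ (Fin 2) :=
  ⟨fun k => if k = k₀ then (Set.projIcc (0 : ℝ) 1 zero_le_one p : ℝ)
    else 1 - Set.projIcc (0 : ℝ) 1 zero_le_one p, by
    have h := (Set.projIcc (0 : ℝ) 1 zero_le_one p).2
    constructor
    · intro k
      dsimp only
      split_ifs
      · exact h.1
      · exact sub_nonneg.2 h.2
    · fin_cases k₀ <;> simp⟩

theorem sum_eq_add_of_ne {k₀ k₁ : Fin 2} (hk : k₀ ≠ k₁) (u : Fin 2 → ℝ) :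
    ∑ k, u k = u k₀ + u k₁ := by
  fin_cases k₀ <;> fin_cases k₁ <;> simp [add_comm] at hk ⊢

theorem edist_weightPoint (k₀ : Fin 2) {x y : ℝ} (hx : x ∈ Set.Icc (0 : ℝ) 1)
    (hy : y ∈ Set.Icc (0 : ℝ) 1) : edist (weightPoint k₀ x) (weightPoint k₀ y) = edist x y := by
  rw [edist_dist, edist_dist]
  congr 1
  rw [Subtype.dist_eq]
  refine le_antisymm ((dist_pi_le_iff dist_nonneg).2 fun k => ?_) ?_
  · simp only [weightPoint, Set.projIcc_of_mem _ hx, Set.projIcc_of_mem _ hy]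
    split_ifs
    · exact le_rfl
    · rw [dist_sub_left]
  · refine le_trans (le_of_eq ?_) (dist_le_pi_dist _ _ k₀)
    simp [weightPoint, Set.projIcc_of_mem _ hx, Set.projIcc_of_mem _ hy]

theorem stdSimplex_two_ext {k₀ : Fin 2} {θ θ' : stdSimplex ℝ (Fin 2)}
    (h : θ.1 k₀ = θ'.1 k₀) : θ = θ' := by
  have h1 := θ.2.2
  have h2 := θ'.2.2
  rw [Fin.sum_univ_two] at h1 h2
  ext k
  change θ.1 k = θ'.1 k
  fin_cases k₀ <;> fin_cases k <;> simp at h ⊢ <;> linarith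

theorem expGradStep_weightPoint {k₀ k₁ : Fin 2} (hk : k₀ ≠ k₁) {η c q : ℝ} {g : Fin 2 → ℝ} {p : ℝ}
    (hg : η * (g k₀ - g k₁) = c * (Set.projIcc (0 : ℝ) 1 zero_le_one p - q)) :
    expGradStep η g (weightPoint k₀ p) = weightPoint k₀ (expWeightsExtend c q p) := by
  refine stdSimplex_two_ext (k₀ := k₀) ?_
  simp only [expGradStep, weightPoint, Set.projIcc_of_mem _ (expWeightsExtend_mem_Icc c q p)]
  rw [sum_eq_add_of_ne hk]
  simp only [if_true, hk.symm, if_false, expWeightsExtend, Set.IccExtend_apply, expWeights]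
  have hmem : max 0 (min 1 p) = (Set.projIcc (0 : ℝ) 1 zero_le_one p : ℝ) := rfl
  rw [hmem, ← hg, show -η * g k₁ = -η * g k₀ + η * (g k₀ - g k₁) by ring, Real.exp_add]
  refine Eq.trans ?_ (mul_div_mul_right _ _ (Real.exp_pos (-η * g k₀)).ne')
  congr 1
  ring

/-- On a symmetric profile the gradient argument is `(L + 1) θ`, with `L` the collective influence.
The difference of its two coordinates is affine in the weight, with slope `2 (a₀ + a₁) (L + 1)` and
zero `q`. -/
theorem LocationScaleMap.semiconj_dynamics {n : ℕ} (M : LocationScaleMap 2 n) (η : ℝ)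
    {k₀ k₁ : Fin 2} (hk : k₀ ≠ k₁) {a₀ a₁ : ℝ} (h₀ : a₀ = M.A k₀ k₀ - M.A k₀ k₁)
    (h₁ : a₁ = M.A k₁ k₁ - M.A k₀ k₁) (ha : 0 < a₀ + a₁) (hL : 0 < M.collectiveInfluence + 1) :
    Function.Semiconj (fun p _ => weightPoint k₀ p)
      (expWeightsExtend (2 * η * (a₀ + a₁) * (M.collectiveInfluence + 1))
        (a₁ / (a₀ + a₁) + (M.b k₀ - M.b k₁) / ((a₀ + a₁) * (M.collectiveInfluence + 1))))
      (M.dynamics fun _ => η) := by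
  intro p
  funext i
  symm
  refine expGradStep_weightPoint hk ?_
  have hsum : ∑ j, M.influence j • (weightPoint k₀ p).1 + (weightPoint k₀ p).1 =
      (M.collectiveInfluence + 1) • (weightPoint k₀ p).1 := by
    rw [← Finset.sum_smul, add_smul, one_smul, collectiveInfluence]
  simp only [M.grad_eq, hsum, Matrix.mulVec_smul, Pi.smul_apply, smul_eq_mul]
  simp only [Matrix.mulVec, dotProduct, sum_eq_add_of_ne hk, weightPoint, if_true, hk.symm,
    if_false]
  rw [M.A_symm k₁ k₀]
  generalize (Set.projIcc (0 : ℝ) 1 zero_le_one p : ℝ) = x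
  field_simp
  rw [h₀, h₁]
  ring

/-! ### Choice of the influence threshold. -/

theorem IsDiagonallyDominant.abs_lt {d : ℕ} {A : Matrix (Fin d) (Fin d) ℝ}
    (hA : IsDiagonallyDominant A) {k l : Fin d} (hkl : k ≠ l) : |A k l| < |A k k| :=
  (Finset.single_le_sum (f := fun l => |A k l|) (fun _ _ => abs_nonneg _)
    (Finset.mem_erase.2 ⟨hkl.symm, Finset.mem_univ l⟩)).trans_lt (hA k)

/-- Chaos for large collective influence when the `k₀`-th diagonal entry is the larger one. -/
theorem exists_chaos_threshold {A : Matrix (Fin 2) (Fin 2) ℝ} (b : Fin 2 → ℝ) {η : ℝ} (hη : 0 < η)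
    {k₀ k₁ : Fin 2} (hk : k₀ ≠ k₁) (h₁ : A k₀ k₁ < A k₁ k₁) (hlt : A k₁ k₁ < A k₀ k₀) :
    ∃ Lstar : ℝ, 0 < Lstar ∧
      ∀ (n : ℕ) (M : LocationScaleMap 2 n), M.A = A → M.b = b →
        Lstar ≤ M.collectiveInfluence →
          IsLiYorkeChaotic (M.dynamics fun _ => η) ∧
            ∀ m : ℕ, 1 ≤ m → ∃ θ : Fin n → stdSimplex ℝ (Fin 2),
              Function.minimalPeriod (M.dynamics fun _ => η) θ = m := by
  obtain ⟨a₀, ha₀⟩ : ∃ a₀, a₀ = A k₀ k₀ - A k₀ k₁ := ⟨_, rfl⟩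
  obtain ⟨a₁, ha₁⟩ : ∃ a₁, a₁ = A k₁ k₁ - A k₀ k₁ := ⟨_, rfl⟩
  have hpos₁ : 0 < a₁ := by linarith
  have hlt' : a₁ < a₀ := by linarith
  have hsum : 0 < a₀ + a₁ := by linarith
  obtain ⟨ρ, hρ⟩ : ∃ ρ, ρ = a₁ / (a₀ + a₁) := ⟨_, rfl⟩
  have hρ0 : 0 < ρ := hρ ▸ div_pos hpos₁ hsum
  have hρ1 : ρ < 1 / 2 := by rw [hρ, div_lt_div_iff₀ hsum two_pos]; linarith
  -- A margin of `2 * κ` around `ρ`: half of it absorbs the shift caused by `b`.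
  obtain ⟨κ, hκ0, hκ1, hκ2⟩ : ∃ κ, 0 < κ ∧ 2 * κ ≤ ρ ∧ 2 * κ ≤ 1 / 2 - ρ :=
    ⟨min ρ (1 / 2 - ρ) / 2, half_pos (lt_min hρ0 (by linarith)),
      by linarith [min_le_left ρ (1 / 2 - ρ)], by linarith [min_le_right ρ (1 / 2 - ρ)]⟩
  obtain ⟨C, hC⟩ := exists_isSnapBackTriple hκ0
  -- The second term makes the intensity exceed `C`, the third bounds the shift by `κ`, and the 1
  -- rules out having no agents, where symmetric profiles would collapse to a point.
  refine ⟨1 + |C| / (2 * η * (a₀ + a₁)) + |b k₀ - b k₁| / ((a₀ + a₁) * κ), by positivity, ?_⟩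
  intro n M hMA hMb hL
  have hC0 : 0 ≤ |C| / (2 * η * (a₀ + a₁)) := by positivity
  have hb0 : 0 ≤ |b k₀ - b k₁| / ((a₀ + a₁) * κ) := by positivity
  have hL1 : 0 < M.collectiveInfluence + 1 := by linarith
  have hn : Nonempty (Fin n) := by
    by_contra hn
    rw [not_nonempty_iff] at hn
    have : M.collectiveInfluence = 0 := by simp [LocationScaleMap.collectiveInfluence]
    linarith
  have hsemi := M.semiconj_dynamics η hk (by rw [hMA]; exact ha₀) (by rw [hMA]; exact ha₁) hsum hL1
  rw [hMb, ← hρ] at hsemi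
  have hc : C ≤ 2 * η * (a₀ + a₁) * (M.collectiveInfluence + 1) := by
    have h1 : |C| / (2 * η * (a₀ + a₁)) ≤ M.collectiveInfluence + 1 := by linarith
    rw [div_le_iff₀ (by positivity)] at h1
    linarith [le_abs_self C]
  have hδ : |(b k₀ - b k₁) / ((a₀ + a₁) * (M.collectiveInfluence + 1))| ≤ κ := by
    have h1 : |b k₀ - b k₁| / ((a₀ + a₁) * κ) ≤ M.collectiveInfluence + 1 := by linarith
    rw [div_le_iff₀ (by positivity)] at h1
    rw [abs_div, abs_of_pos (mul_pos hsum hL1), div_le_iff₀ (mul_pos hsum hL1)]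
    linarith
  obtain ⟨hδ1, hδ2⟩ := abs_le.1 hδ
  obtain ⟨lo, hi, htriple, hmem⟩ := hC _ _ hc
    (show κ ≤ ρ + (b k₀ - b k₁) / ((a₀ + a₁) * (M.collectiveInfluence + 1)) by linarith)
    (by linarith)
  have hIcc : ∀ i, Set.Icc (lo i) (hi i) ⊆ Set.Icc 0 1 := fun i =>
    Set.Icc_subset_Icc (hmem i).1 (hmem i).2
  have hs : Set.MapsTo (expWeightsExtend (2 * η * (a₀ + a₁) * (M.collectiveInfluence + 1))
      (ρ + (b k₀ - b k₁) / ((a₀ + a₁) * (M.collectiveInfluence + 1))))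
      (Set.Icc 0 1) (Set.Icc 0 1) := fun p _ => expWeightsExtend_mem_Icc _ _ p
  have hiso : ∀ x ∈ Set.Icc (0 : ℝ) 1, ∀ y ∈ Set.Icc (0 : ℝ) 1,
      edist (fun _ : Fin n => weightPoint k₀ x) (fun _ : Fin n => weightPoint k₀ y) =
        edist x y := fun x hx y hy => by
    rw [edist_pi_const, edist_weightPoint k₀ hx hy]
  refine ⟨?_, fun m hm => ?_⟩
  · obtain ⟨S, hS, hunc, hpair⟩ := htriple.exists_scrambled
    exact isLiYorkeChaotic_of_semiconj hs hsemi hiso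
      (fun x hx => let ⟨i, hxi⟩ := hS x hx; hIcc i hxi) hunc hpair
  · obtain ⟨i, x, hx, hper⟩ := htriple.exists_minimalPeriod_eq hm
    exact ⟨_, (minimalPeriod_of_semiconj hs hsemi hiso (hIcc i hx)).trans hper⟩

theorem mainTheorem2 (A : Matrix (Fin 2) (Fin 2) ℝ) (b : Fin 2 → ℝ) (η : ℝ) (hη : 0 < η)
    (hA : IsDiagonallyDominant A) (hne : A 0 0 ≠ A 1 1) :
    ∃ Lstar : ℝ, 0 < Lstar ∧
      ∀ (n : ℕ) (M : LocationScaleMap 2 n), M.A = A → M.b = b →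
        Lstar ≤ M.collectiveInfluence →
          IsLiYorkeChaotic (M.dynamics fun _ => η) ∧
            ∀ m : ℕ, 1 ≤ m → ∃ θ : Fin n → stdSimplex ℝ (Fin 2),
              Function.minimalPeriod (M.dynamics fun _ => η) θ = m := by
  -- Symmetry and a nonnegative diagonal come from `A` being a second-moment matrix; if no map
  -- realises `A`, any threshold works.
  by_cases hM : ∃ (n : ℕ) (M : LocationScaleMap 2 n), M.A = A
  · obtain ⟨n, M, rfl⟩ := hM
    have hdiag : ∀ k l, k ≠ l → M.A k l < M.A k k := fun k l hkl => by
      have := hA.abs_lt hkl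
      rw [abs_of_nonneg (M.A_diag_nonneg k)] at this
      exact (le_abs_self _).trans_lt this
    rcases hne.lt_or_gt with h | h
    · exact exists_chaos_threshold b hη (k₀ := 1) (k₁ := 0) (by decide)
        (M.A_symm 1 0 ▸ hdiag 0 1 (by decide)) h
    · exact exists_chaos_threshold b hη (k₀ := 0) (k₁ := 1) (by decide)
        (M.A_symm 0 1 ▸ hdiag 1 0 (by decide)) h
  · exact ⟨1, one_pos, fun n M hMA => absurd ⟨n, M, hMA⟩ hM⟩
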